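/- Fix $m,n\in\mathbb N$. A linearly constrained quadratic program (LCQP) is $$\min_{x\in\mathbb R^n}\ \tfrac12 x^\top Qx+c^\top x\quad\text{s.t.}\quad Ax\circ b,\ \ l\le x\le u,$$ with $A\in\mathbb R^{m\times n}$, $b\in\mathbb R^m$, $c\in\mathbb R^n$, $Q\in\mathbb R^{n\times n}$ symmetric positive semidefinite, $l\in(\mathbb R\cup\{-\infty\})^n$, $u\in(\mathbb R\cup\{+\infty\})^n$, $\circ\in\{\le,=,\ge\}^m$. Let $\mathcal G^{m,n}$ be the set of all such data $G=(A,b,c,Q,l,u,\circ)$ with the subspace topology of the product, where $\{\le,=,\ge\}$ is discrete and $\mathbb R\cup\{\pm\infty\}$ are disjoint unions (so $\pm\infty$ are isolated points). Let $\Phi_{\rm obj}(G)\in\mathbb R\cup\{\pm\infty\}$ be the infimum of the objective over the feasible set ($+\infty$ if infeasible, $-\infty$ if unbounded). A message-passing GNN with node-level output is given by $L\ge 0$ and continuous maps $f_l^V,f_l^W$ $(0\le l\le L)$, $g_l^V,g_l^W,g_l^Q$ $(1\le l\le L)$, $r_2$ between finite-dimensional feature spaces (of arbitrary dimensions, not depending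 on $m,n$); on $G$ it computes $s_i^0=f_0^V(b_i,\circ_i)$, $t_j^0=f_0^W(c_j,l_j,u_j)$, then for $1\le l\le L$ $$s_i^l=f_l^V\Big(s_i^{l-1},\sum_j A_{ij}g_l^W(t_j^{l-1})\Big),\qquad t_j^l=f_l^W\Big(t_j^{l-1},\sum_i A_{ij}g_l^V(s_i^{l-1}),\sum_{j'}Q_{jj'}g_l^Q(t_{j'}^{l-1})\Big),$$ and outputs $F_W(G)\in\mathbb R^n$ with entries $F_W(G)_j=r_2\big(\sum_i s_i^L,\sum_{j'}t_{j'}^L,t_j^L\big)\in\mathbb R$. Theorem. Every $G\in\mathcal G^{m,n}$ with $\Phi_{\rm obj}(G)\in\mathbb R$ has a unique optimal solution of smallest $\ell_2$-norm, denoted $\Phi_{\rm sol}(G)$. Moreover, let $\mathbb P$ be a Borel regular probability measure on $\mathcal G^{m,n}$ with $\mathbb P[\Phi_{\rm obj}(G)\in\mathbb R]=1$. Then for all $\epsilon,\delta>0$ there is a message-passing GNN $F_W$ with node-level output such that $$\mathbb P\big[\|F_W(G)-\Phi_{\rm sol}(G)\|>\delta\big]<\epsilon,$$ where $\|\cdot\|$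 is the $\ell_2$-norm. -/

import Mathlib

open MeasureTheory

/-- The type of a single linear constraint: `(Ax)_i ≤ b_i`, `(Ax)_i = b_i` or `(Ax)_i ≥ b_i`. -/
inductive ConstraintSense : Type
  | le : ConstraintSense
  | eq : ConstraintSense
  | ge : ConstraintSense

namespace ConstraintSense

/-- The set `{≤, =, ≥}` carries the discrete topology. -/
instance : TopologicalSpace ConstraintSense := ⊥

instance : DiscreteTopology ConstraintSense := ⟨rfl⟩

/-- `o.holds s t` is the relation `s ∘ t` for `∘ = o`. -/
def holds : ConstraintSense → ℝ → ℝ → Prop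
  | le, s, t => s ≤ t
  | eq, s, t => s = t
  | ge, s, t => s ≥ t

end ConstraintSense

/-- Lower bounds, the set `ℝ ∪ {-∞}`: `Sum.inl a` is the real number `a` and `Sum.inr ()` is `-∞`.
The topology is that of the disjoint union, so `-∞` is an isolated point. -/
abbrev LowerBound : Type := ℝ ⊕ Unit

/-- Upper bounds, the set `ℝ ∪ {+∞}`: `Sum.inl a` is the real number `a` and `Sum.inr ()` is `+∞`.
The topology is that of the disjoint union, so `+∞` is an isolated point. -/
abbrev UpperBound : Type := ℝ ⊕ Unit

/-- `l ≤ x` for `l ∈ ℝ ∪ {-∞}` and a real number `x`. -/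
def LowerBound.holds : LowerBound → ℝ → Prop
  | Sum.inl a, x => a ≤ x
  | Sum.inr _, _ => True

/-- `x ≤ u` for `u ∈ ℝ ∪ {+∞}` and a real number `x`. -/
def UpperBound.holds : UpperBound → ℝ → Prop
  | Sum.inl a, x => x ≤ a
  | Sum.inr _, _ => True

/-- An LCQP-graph with `m` constraint nodes and `n` variable nodes, that is, the data of
`min ½ xᵀQx + cᵀx  s.t.  Ax ∘ b, l ≤ x ≤ u` with `Q` symmetric positive semidefinite.
`A` and `Q` are the edge weights (an absent edge has weight `0`), `(b i, sense i)` is the feature of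
the constraint node `i`, and `(c j, l j, u j)` is the feature of the variable node `j`. -/
structure LCQPGraph (m n : ℕ) : Type where
  A : Matrix (Fin m) (Fin n) ℝ
  b : Fin m → ℝ
  c : Fin n → ℝ
  Q : Matrix (Fin n) (Fin n) ℝ
  l : Fin n → LowerBound
  u : Fin n → UpperBound
  sense : Fin m → ConstraintSense
  /-- `Q` is symmetric and positive semidefinite (over `ℝ`, Mathlib's notion includes symmetry). -/
  posSemidef : Q.PosSemidef

namespace LCQPGraph

variable {m n : ℕ}

/-- The tuple `(A, b, c, Q, l, u, ∘)` as a point of the ambient product space. -/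
def toProd (G : LCQPGraph m n) :
    Matrix (Fin m) (Fin n) ℝ × (Fin m → ℝ) × (Fin n → ℝ) × Matrix (Fin n) (Fin n) ℝ ×
      (Fin n → LowerBound) × (Fin n → UpperBound) × (Fin m → ConstraintSense) :=
  (G.A, G.b, G.c, G.Q, G.l, G.u, G.sense)

/-- The subspace topology induced from the product space. -/
instance : TopologicalSpace (LCQPGraph m n) :=
  TopologicalSpace.induced toProd inferInstance

/-- The Borel σ-algebra. -/
instance : MeasurableSpace (LCQPGraph m n) := borel (LCQPGraph m n)

instance : BorelSpace (LCQPGraph m n) := ⟨rfl⟩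

/-- `x` is a feasible solution: `Ax ∘ b` and `l ≤ x ≤ u`. -/
def IsFeasible (G : LCQPGraph m n) (x : EuclideanSpace ℝ (Fin n)) : Prop :=
  (∀ i, (G.sense i).holds (∑ j, G.A i j * x j) (G.b i)) ∧
    (∀ j, LowerBound.holds (G.l j) (x j)) ∧ (∀ j, UpperBound.holds (G.u j) (x j))

/-- The objective function `½ xᵀQx + cᵀx`. -/
noncomputable def objective (G : LCQPGraph m n) (x : EuclideanSpace ℝ (Fin n)) : ℝ :=
  (1 / 2 : ℝ) * ∑ j, ∑ j', x j * G.Q j j' * x j' + ∑ j, G.c j * x j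

/-- The optimal objective value `Φ_obj(G) ∈ ℝ ∪ {±∞}`, the infimum of the objective over the
feasible set: `⊤` iff the problem is infeasible, `⊥` iff it is unbounded. -/
noncomputable def optValue (G : LCQPGraph m n) : EReal :=
  ⨅ (x : EuclideanSpace ℝ (Fin n)) (_ : G.IsFeasible x), (G.objective x : EReal)

/-- The problem is feasible and bounded: `Φ_obj(G) ∈ ℝ`. -/
def FeasibleBounded (G : LCQPGraph m n) : Prop :=
  ∃ r : ℝ, G.optValue = (r : EReal)

/-- `x` is an optimal solution. -/
def IsOptimal (G : LCQPGraph m n) (x : EuclideanSpace ℝ (Fin n)) : Prop :=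
  G.IsFeasible x ∧ ∀ y, G.IsFeasible y → G.objective x ≤ G.objective y

/-- `x` is an optimal solution with the smallest `ℓ²`-norm. -/
def IsMinNormOptimal (G : LCQPGraph m n) (x : EuclideanSpace ℝ (Fin n)) : Prop :=
  G.IsOptimal x ∧ ∀ y, G.IsOptimal y → ‖x‖ ≤ ‖y‖

open Classical in
/-- The optimal solution mapping `Φ_sol`: the optimal solution with the smallest `ℓ²`-norm.
(The value is irrelevant where there is no such solution.) -/
noncomputable def sol (G : LCQPGraph m n) : EuclideanSpace ℝ (Fin n) :=
  if h : ∃ x, G.IsMinNormOptimal x then h.choose else 0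

end LCQPGraph

/-- The embedding and message-passing layers of a GNN. An element of `MessagePassing p q` computes
for every LCQP-graph (of any size) a feature `s_i ∈ ℝ^p` for each constraint node `i` and a feature
`t_j ∈ ℝ^q` for each variable node `j`. All maps are continuous, the number of layers and all
feature dimensions are arbitrary, and nothing depends on the size of the graph. -/
inductive MessagePassing : ℕ → ℕ → Type
  /-- The initial embeddings `f₀^V`, `f₀^W` (no message-passing layer yet). -/
  | embed {p q : ℕ}
      (fV : C(ℝ × ConstraintSense, Fin p → ℝ))
      (fW : C(ℝ × LowerBound × UpperBound, Fin q → ℝ)) : MessagePassing p q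
  /-- One more layer, with the maps `g^V`, `g^W`, `g^Q`, `f^V`, `f^W`. -/
  | layer {p q p' q' dV dW dQ : ℕ} (N : MessagePassing p q)
      (gV : C(Fin p → ℝ, Fin dV → ℝ))
      (gW : C(Fin q → ℝ, Fin dW → ℝ))
      (gQ : C(Fin q → ℝ, Fin dQ → ℝ))
      (fV : C((Fin p → ℝ) × (Fin dW → ℝ), Fin p' → ℝ))
      (fW : C((Fin q → ℝ) × (Fin dV → ℝ) × (Fin dQ → ℝ), Fin q' → ℝ)) : MessagePassing p' q'

namespace MessagePassing

/-- The node features `((s_i)_i, (t_j)_j)` after the last layer. -/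
noncomputable def features {m n : ℕ} (G : LCQPGraph m n) :
    {p q : ℕ} → MessagePassing p q → (Fin m → Fin p → ℝ) × (Fin n → Fin q → ℝ)
  | _, _, embed fV fW =>
      (fun i => fV (G.b i, G.sense i), fun j => fW (G.c j, G.l j, G.u j))
  | _, _, layer N gV gW gQ fV fW =>
      let s := (features G N).1
      let t := (features G N).2
      (fun i => fV (s i, ∑ j, G.A i j • gW (t j)),
       fun j => fW (t j, ∑ i, G.A i j • gV (s i), ∑ j', G.Q j j' • gQ (t j')))

end MessagePassing

/-- A message-passing GNN with node-level output (the class `F^W_LCQP`): message-passing layers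
followed by a continuous readout `r₂`. -/
structure NodeGNN : Type where
  p : ℕ
  q : ℕ
  layers : MessagePassing p q
  r : C((Fin p → ℝ) × (Fin q → ℝ) × (Fin q → ℝ), ℝ)

namespace NodeGNN

/-- The output `y_j = r₂(∑ i, s_i, ∑ j', t_{j'}, t_j)`. -/
noncomputable def eval (F : NodeGNN) {m n : ℕ} (G : LCQPGraph m n) : EuclideanSpace ℝ (Fin n) :=
  let s := (F.layers.features G).1
  let t := (F.layers.features G).2
  WithLp.toLp 2 fun j => F.r (∑ i, s i, ∑ j', t j', t j)

end NodeGNN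

/-!
Message-passing GNNs can run gradient descent. One gradient step for the penalized and Tikhonov
regularized objective `½ xᵀQx + cᵀx + (κ/2)‖x‖² + (ρ/2) ∑ (constraint violations)²` needs only
products with `Q`, `A` and `Aᵀ` and continuous functions of the node features, hence two
message-passing layers (`NodeGNN.descent_eval`). So it suffices to reach `Φ_sol` from the gradient
descent iterates by finitely many limits that hold separately for every feasible and bounded
problem: on a probability space, almost everywhere convergence implies convergence in measure, and
therefore the functions that GNNs approximate in measure are closed under almost everywhere limits
(`GNNApproximable.of_tendsto_ae`). There are three limits.

* With step size `1 / (k + 1)` and `(k + 1)²` steps, gradient descent tends to the zero of the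
  gradient, because a step contracts as soon as its size is small, whatever the Lipschitz constant
  (`IntervalQP.tendsto_iterate_step`).
* As `ρ → ∞`, these zeros tend to the minimizer of the `κ`-regularized objective on the feasible set
  (`IntervalQP.tendsto_penalized`).
* As `κ → 0`, these minimizers tend to the solution of smallest norm
  (`IntervalQP.tendsto_isMinNormMin`).

In the last limit the point is that the regularized minimizers stay bounded
(`IntervalQP.exists_norm_le_of_isMin`). This is where polyhedrality enters: if they ran off to
infinity, then stepping back along their asymptotic direction would preserve feasibility, not
increase the objective and decrease the norm. Their cluster points are then optimal solutions of
smallest norm, which also proves existence; uniqueness holds because the set of optimal solutions is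
convex.
-/

open Filter Topology

open scoped RealInnerProductSpace

/-! ### Residuals of closed intervals -/

/-- `v` is the residual map `s ↦ s - P_S s` of the metric projection `P_S` onto a closed convex set
`S ⊆ ℝ`. The projection is described by its variational inequality. -/
def IsResidual (S : Set ℝ) (v : ℝ → ℝ) : Prop :=
  ∀ s, s - v s ∈ S ∧ ∀ q ∈ S, 0 ≤ v s * (s - v s - q)

namespace IsResidual

variable {S : Set ℝ} {v : ℝ → ℝ}

lemma eq_zero_iff (h : IsResidual S v) {s : ℝ} : v s = 0 ↔ s ∈ S := by
  refine ⟨fun h0 => by simpa [h0] using (h s).1, fun hs => ?_⟩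
  nlinarith [(h s).2 s hs]

/-- The residual map is firmly nonexpansive. -/
lemma sq_sub_le (h : IsResidual S v) (s t : ℝ) :
    (v s - v t) ^ 2 ≤ (v s - v t) * (s - t) := by
  nlinarith [(h s).2 _ (h t).1, (h t).2 _ (h s).1]

lemma mul_sub_nonneg (h : IsResidual S v) (s t : ℝ) : 0 ≤ (v s - v t) * (s - t) :=
  (sq_nonneg _).trans (h.sq_sub_le s t)

lemma abs_sub_le (h : IsResidual S v) (s t : ℝ) : |v s - v t| ≤ |s - t| := by
  have h1 := h.sq_sub_le s t
  by_contra! h2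
  have h3 : (v s - v t) * (s - t) ≤ |v s - v t| * |s - t| := by
    rw [← abs_mul]; exact le_abs_self _
  nlinarith [sq_abs (v s - v t), abs_nonneg (s - t), abs_nonneg (v s - v t)]

lemma continuous (h : IsResidual S v) : Continuous v := by
  refine LipschitzWith.continuous (K := 1) (LipschitzWith.of_dist_le_mul fun s t => ?_)
  simpa [Real.dist_eq] using h.abs_sub_le s t

/-- Half the squared residual is convex with derivative the residual. -/
lemma half_sq_add_le (h : IsResidual S v) (s t : ℝ) :
    v s ^ 2 / 2 + v s * (t - s) ≤ v t ^ 2 / 2 := by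
  nlinarith [(h s).2 _ (h t).1, sq_nonneg (v t - v s)]

lemma isClosed (h : IsResidual S v) : IsClosed S := by
  have : S = v ⁻¹' {0} := by ext s; simp [h.eq_zero_iff]
  rw [this]
  exact isClosed_singleton.preimage h.continuous

lemma ordConnected (h : IsResidual S v) : S.OrdConnected := by
  refine ⟨fun p hp q hq s hs => ?_⟩
  rw [← h.eq_zero_iff]
  obtain ⟨h1, h2⟩ := hs
  have e1 := (h s).2 p hp
  have e2 := (h s).2 q hq
  rcases le_total 0 (v s) with h0 | h0
  · nlinarith [mul_nonneg h0 (sub_nonneg.2 h2)]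
  · nlinarith [mul_nonneg (neg_nonneg.2 h0) (sub_nonneg.2 h1)]

end IsResidual

/-- If points `x k` of an interval, rescaled by `r k → ∞`, tend to `σ`, then `σ` is a recession
direction of the interval. -/
lemma Set.OrdConnected.add_mul_mem_of_tendsto_div {S : Set ℝ} (hS : S.OrdConnected) {x r : ℕ → ℝ}
    {σ : ℝ} (hx : ∀ k, x k ∈ S) (hr : Tendsto r atTop atTop)
    (h : Tendsto (fun k => x k / r k) atTop (𝓝 σ)) {s t : ℝ} (hs : s ∈ S) (ht : 0 ≤ t) :
    s + t * σ ∈ S := by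
  have hxr : ∀ᶠ k in atTop, r k * (x k / r k) = x k := by
    filter_upwards [hr.eventually_gt_atTop 0] with k hk
    field_simp
  rcases lt_trichotomy σ 0 with h0 | h0 | h0
  · have h1 : Tendsto x atTop atBot := (hr.atTop_mul_neg h0 h).congr' hxr
    obtain ⟨k, hk⟩ := (h1.eventually_le_atBot (s + t * σ)).exists
    exact hS.out (hx k) hs ⟨hk, by nlinarith⟩
  · simpa [h0] using hs
  · have h1 : Tendsto x atTop atTop := (hr.atTop_mul_pos h0 h).congr' hxr
    obtain ⟨k, hk⟩ := (h1.eventually_ge_atTop (s + t * σ)).exists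
    exact hS.out hs (hx k) ⟨by nlinarith, hk⟩

/-- Under the same assumptions, one may eventually step back from `x k` by `σ` inside the
interval. -/
lemma Set.OrdConnected.eventually_sub_mem_of_tendsto_div {S : Set ℝ} (hS : S.OrdConnected)
    {x r : ℕ → ℝ} {σ : ℝ} (hx : ∀ k, x k ∈ S) (hr : Tendsto r atTop atTop)
    (h : Tendsto (fun k => x k / r k) atTop (𝓝 σ)) : ∀ᶠ k in atTop, x k - σ ∈ S := by
  have hxr : ∀ᶠ k in atTop, r k * (x k / r k) = x k := by
    filter_upwards [hr.eventually_gt_atTop 0] with k hk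
    field_simp
  rcases lt_trichotomy σ 0 with h0 | h0 | h0
  · have h1 : Tendsto x atTop atBot := (hr.atTop_mul_neg h0 h).congr' hxr
    filter_upwards [h1.eventually_le_atBot (x 0 + σ)] with k hk
    exact hS.out (hx k) (hx 0) ⟨by linarith, by linarith⟩
  · exact Eventually.of_forall fun k => by simpa [h0] using hx k
  · have h1 : Tendsto x atTop atTop := (hr.atTop_mul_pos h0 h).congr' hxr
    filter_upwards [h1.eventually_ge_atTop (x 0 + σ)] with k hk
    exact hS.out (hx 0) (hx k) ⟨by linarith, by linarith⟩

lemma tendsto_of_bounded_of_unique_subseq_limit {E : Type*} [NormedAddCommGroup E] [ProperSpace E]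
    {x : ℕ → E} {z : E} {C : ℝ} (hC : ∀ k, ‖x k‖ ≤ C)
    (h : ∀ φ : ℕ → ℕ, StrictMono φ → ∀ y, Tendsto (x ∘ φ) atTop (𝓝 y) → y = z) :
    Tendsto x atTop (𝓝 z) := by
  refine (isCompact_closedBall (0 : E) C).tendsto_nhds_of_unique_mapClusterPt
    (Eventually.of_forall fun k => by simpa using hC k) fun y _ hy => ?_
  obtain ⟨φ, hφ, hlim⟩ := hy.tendsto_subseq
  exact h φ hφ y hlim

/-! ### Convex quadratic programs with interval constraints -/

/-- The convex quadratic program `min ½⟪Qx, x⟫ + ⟪c, x⟫` subject to `⟪a i, x⟫ ∈ S i` for all `i`,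
where each `S i` is a closed interval that comes with its residual map `v i`. -/
structure IntervalQP (E ι : Type*) [NormedAddCommGroup E] [InnerProductSpace ℝ E] where
  Q : E →L[ℝ] E
  isPositive : Q.IsPositive
  c : E
  a : ι → E
  S : ι → Set ℝ
  v : ι → ℝ → ℝ
  residual : ∀ i, IsResidual (S i) (v i)

namespace IntervalQP

variable {E ι : Type*} [NormedAddCommGroup E] [InnerProductSpace ℝ E] (P : IntervalQP E ι)

/-- The feasible set. -/
def feasible : Set E := {x | ∀ i, ⟪P.a i, x⟫ ∈ P.S i}

/-- The Tikhonov regularized objective `½⟪Qx, x⟫ + ⟪c, x⟫ + (κ / 2)‖x‖²`; the objective itself is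
the case `κ = 0`. -/
noncomputable def obj (κ : ℝ) (x : E) : ℝ := ⟪P.Q x, x⟫ / 2 + ⟪P.c, x⟫ + κ / 2 * ‖x‖ ^ 2

/-- `x` minimizes the `κ`-regularized objective on the feasible set. -/
def IsMin (κ : ℝ) (x : E) : Prop := x ∈ P.feasible ∧ ∀ y ∈ P.feasible, P.obj κ x ≤ P.obj κ y

/-- `x` is a minimizer of the objective of smallest norm. -/
def IsMinNormMin (x : E) : Prop := P.IsMin 0 x ∧ ∀ y, P.IsMin 0 y → ‖x‖ ≤ ‖y‖

lemma inner_Q_comm (x y : E) : ⟪P.Q x, y⟫ = ⟪P.Q y, x⟫ := by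
  rw [P.isPositive.isSymmetric.apply_clm, real_inner_comm]

lemma inner_Q_nonneg (x : E) : 0 ≤ ⟪P.Q x, x⟫ := P.isPositive.inner_nonneg_left x

lemma obj_add_smul (κ : ℝ) (x d : E) (t : ℝ) :
    P.obj κ (x + t • d) = P.obj κ x + t * (⟪P.Q x, d⟫ + ⟪P.c, d⟫ + κ * ⟪x, d⟫)
      + t ^ 2 * (⟪P.Q d, d⟫ / 2 + κ / 2 * ‖d‖ ^ 2) := by
  have h := P.inner_Q_comm d x
  simp only [obj, ← real_inner_self_eq_norm_sq, map_add, map_smul, inner_add_left,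
    inner_add_right, real_inner_smul_left, real_inner_smul_right]
  rw [h, real_inner_comm x d]
  ring

lemma obj_midpoint_le (κ : ℝ) (x y : E) :
    P.obj κ ((1 / 2 : ℝ) • (x + y)) ≤
      (P.obj κ x + P.obj κ y) / 2 - κ / 8 * ‖x - y‖ ^ 2 := by
  have h1 : (1 / 2 : ℝ) • (x + y) = y + (1 / 2 : ℝ) • (x - y) := by module
  have h2 : x = y + (1 : ℝ) • (x - y) := by module
  have e1 := P.obj_add_smul κ y (x - y) (1 / 2)
  have e2 := P.obj_add_smul κ y (x - y) 1
  rw [← h1] at e1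
  rw [← h2] at e2
  nlinarith [P.inner_Q_nonneg (x - y)]

lemma obj_eq_obj_zero_add (κ : ℝ) (x : E) : P.obj κ x = P.obj 0 x + κ / 2 * ‖x‖ ^ 2 := by
  simp [obj]

lemma le_obj {κ : ℝ} (x : E) : κ / 2 * ‖x‖ ^ 2 - ‖P.c‖ * ‖x‖ ≤ P.obj κ x := by
  have h1 := (abs_le.1 (abs_real_inner_le_norm P.c x)).1
  have h2 := P.inner_Q_nonneg x
  rw [obj]
  linarith

/-- Sublevel sets of the regularized objective are bounded. -/
lemma exists_norm_le_of_obj_le {κ : ℝ} (hκ : 0 < κ) (M : ℝ) :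
    ∃ C, ∀ x, P.obj κ x ≤ M → ‖x‖ ≤ C := by
  refine ⟨2 * (‖P.c‖ + |M|) / κ + 1, fun x hx => ?_⟩
  by_contra! h
  have h1 := (P.le_obj (κ := κ) x).trans hx
  have h0 : 0 ≤ 2 * (‖P.c‖ + |M|) / κ := by positivity
  have h2 : 2 * (‖P.c‖ + |M|) < κ * ‖x‖ := by
    have : 2 * (‖P.c‖ + |M|) / κ < ‖x‖ := by linarith
    rwa [div_lt_iff₀' hκ] at this
  nlinarith [le_abs_self M, abs_nonneg M]

lemma continuous_obj (κ : ℝ) : Continuous (P.obj κ) := by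
  unfold obj
  fun_prop

lemma isClosed_feasible : IsClosed P.feasible := by
  simp only [feasible, Set.ofPred_forall]
  exact isClosed_iInter fun i => (P.residual i).isClosed.preimage (by fun_prop)

lemma convex_feasible : Convex ℝ P.feasible := by
  intro x hx y hy s t hs ht hst i
  have := (P.residual i).ordConnected.convex (hx i) (hy i) hs ht hst
  simpa [inner_add_right, real_inner_smul_right] using this

lemma midpoint_mem_feasible {x y : E} (hx : x ∈ P.feasible) (hy : y ∈ P.feasible) :
    (1 / 2 : ℝ) • (x + y) ∈ P.feasible := by
  rw [smul_add]
  exact P.convex_feasible hx hy (by norm_num) (by norm_num) (by norm_num)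

lemma IsMin.unique {P : IntervalQP E ι} {κ : ℝ} (hκ : 0 < κ) {x y : E} (hx : P.IsMin κ x)
    (hy : P.IsMin κ y) : x = y := by
  have hm := P.midpoint_mem_feasible hx.1 hy.1
  have h1 := hx.2 _ hm
  have h2 := hy.2 _ hm
  have h3 := P.obj_midpoint_le κ x y
  have h4 : κ * ‖x - y‖ ^ 2 ≤ 0 := by linarith
  have h5 : ‖x - y‖ ^ 2 = 0 := le_antisymm (by nlinarith) (sq_nonneg _)
  rw [sq_eq_zero_iff, norm_eq_zero] at h5
  exact sub_eq_zero.1 h5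

/-- Two minimizers of smallest norm agree, since otherwise their midpoint, again a minimizer, would
be shorter. -/
lemma IsMinNormMin.unique {P : IntervalQP E ι} {x y : E} (hx : P.IsMinNormMin x)
    (hy : P.IsMinNormMin y) : x = y := by
  have hm : P.IsMin 0 ((1 / 2 : ℝ) • (x + y)) := by
    refine ⟨P.midpoint_mem_feasible hx.1.1 hy.1.1, fun z hz => ?_⟩
    have := P.obj_midpoint_le 0 x y
    linarith [hx.1.2 z hz, hy.1.2 z hz]
  have h1 := hx.2 _ hm
  have h2 := hy.2 _ hm
  rw [norm_smul, Real.norm_of_nonneg (by norm_num)] at h1 h2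
  have h3 := parallelogram_law_with_norm ℝ x y
  have h4 : ‖x - y‖ * ‖x - y‖ = 0 := by
    refine le_antisymm ?_ (mul_self_nonneg _)
    nlinarith [norm_nonneg x, norm_nonneg y]
  rw [mul_self_eq_zero, norm_eq_zero] at h4
  exact sub_eq_zero.1 h4

/-! ### Gradient descent for the penalized problem -/

section Gradient

variable [Fintype ι]

/-- The gradient of `x ↦ obj κ x + (ρ / 2) ∑ i, (v i ⟪a i, x⟫)²`, where the sum is the squared
constraint violation. -/
noncomputable def grad (κ ρ : ℝ) (x : E) : E :=
  P.Q x + P.c + κ • x + ρ • ∑ i, P.v i ⟪P.a i, x⟫ • P.a i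

/-- The squared constraint violation. -/
noncomputable def violation (x : E) : ℝ := ∑ i, P.v i ⟪P.a i, x⟫ ^ 2

lemma continuous_violation : Continuous P.violation := by
  unfold violation
  exact continuous_finsetSum _ fun i _ => ((P.residual i).continuous.comp (by fun_prop)).pow 2

lemma violation_nonneg (x : E) : 0 ≤ P.violation x := Finset.sum_nonneg fun _ _ => sq_nonneg _

lemma violation_eq_zero_iff {x : E} : P.violation x = 0 ↔ x ∈ P.feasible := by
  rw [violation, Finset.sum_eq_zero_iff_of_nonneg fun _ _ => sq_nonneg _]
  simp [feasible, (P.residual _).eq_zero_iff]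

lemma grad_sub_grad (κ ρ : ℝ) (x y : E) :
    P.grad κ ρ x - P.grad κ ρ y = P.Q (x - y) + κ • (x - y) +
      ρ • ∑ i, (P.v i ⟪P.a i, x⟫ - P.v i ⟪P.a i, y⟫) • P.a i := by
  simp only [grad, sub_smul, Finset.sum_sub_distrib, map_sub, smul_sub]
  abel

lemma le_inner_grad_sub_grad {κ ρ : ℝ} (hρ : 0 ≤ ρ) (x y : E) :
    κ * ‖x - y‖ ^ 2 ≤ ⟪P.grad κ ρ x - P.grad κ ρ y, x - y⟫ := by
  rw [grad_sub_grad, inner_add_left, inner_add_left, real_inner_smul_left, real_inner_smul_left,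
    real_inner_self_eq_norm_sq, sum_inner]
  have h : 0 ≤ ∑ i, ⟪(P.v i ⟪P.a i, x⟫ - P.v i ⟪P.a i, y⟫) • P.a i, x - y⟫ := by
    refine Finset.sum_nonneg fun i _ => ?_
    rw [real_inner_smul_left, inner_sub_right]
    exact (P.residual i).mul_sub_nonneg _ _
  nlinarith [P.inner_Q_nonneg (x - y), mul_nonneg hρ h]

lemma exists_lipschitz_grad {κ ρ : ℝ} (hκ : 0 ≤ κ) (hρ : 0 ≤ ρ) :
    ∃ L : ℝ, ∀ x y, ‖P.grad κ ρ x - P.grad κ ρ y‖ ≤ L * ‖x - y‖ := by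
  refine ⟨‖P.Q‖ + κ + ρ * ∑ i, ‖P.a i‖ * ‖P.a i‖, fun x y => ?_⟩
  rw [grad_sub_grad, add_mul, add_mul]
  refine (norm_add₃_le).trans (add_le_add_three (P.Q.le_opNorm _) ?_ ?_)
  · rw [norm_smul, Real.norm_of_nonneg hκ]
  · rw [norm_smul, Real.norm_of_nonneg hρ, mul_assoc, Finset.sum_mul]
    refine mul_le_mul_of_nonneg_left (norm_sum_le_of_le _ fun i _ => ?_) hρ
    rw [norm_smul, Real.norm_eq_abs]
    have h := ((P.residual i).abs_sub_le ⟪P.a i, x⟫ ⟪P.a i, y⟫)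
    rw [← inner_sub_right] at h
    nlinarith [h.trans (abs_real_inner_le_norm _ _), norm_nonneg (P.a i)]

/-- The penalized objective is convex, so its gradient gives affine minorants. -/
lemma obj_add_inner_grad_le {κ ρ : ℝ} (hκ : 0 ≤ κ) (hρ : 0 ≤ ρ) (x y : E) :
    P.obj κ x + ρ / 2 * P.violation x + ⟪P.grad κ ρ x, y - x⟫ ≤
      P.obj κ y + ρ / 2 * P.violation y := by
  have h1 := P.obj_add_smul κ x (y - x) 1
  rw [show x + (1 : ℝ) • (y - x) = y by module] at h1
  have h2 : P.violation x / 2 + ∑ i, P.v i ⟪P.a i, x⟫ * ⟪P.a i, y - x⟫ ≤ P.violation y / 2 := by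
    rw [violation, violation, Finset.sum_div, Finset.sum_div, ← Finset.sum_add_distrib]
    refine Finset.sum_le_sum fun i _ => ?_
    rw [inner_sub_right]
    exact (P.residual i).half_sq_add_le _ _
  have h3 : ⟪P.grad κ ρ x, y - x⟫ = ⟪P.Q x, y - x⟫ + ⟪P.c, y - x⟫ + κ * ⟪x, y - x⟫ +
      ρ * ∑ i, P.v i ⟪P.a i, x⟫ * ⟪P.a i, y - x⟫ := by
    simp only [grad, inner_add_left, real_inner_smul_left, sum_inner]
  rw [h1, h3]
  nlinarith [mul_le_mul_of_nonneg_left h2 hρ, P.inner_Q_nonneg (y - x),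
    mul_nonneg hκ (sq_nonneg ‖y - x‖)]

lemma obj_add_violation_le_of_grad_eq_zero {P : IntervalQP E ι} {κ ρ : ℝ} (hκ : 0 ≤ κ) (hρ : 0 ≤ ρ)
    {x y : E} (hx : P.grad κ ρ x = 0) (hy : y ∈ P.feasible) :
    P.obj κ x + ρ / 2 * P.violation x ≤ P.obj κ y := by
  have h := P.obj_add_inner_grad_le hκ hρ x y
  rwa [hx, inner_zero_left, P.violation_eq_zero_iff.2 hy, mul_zero, add_zero, add_zero] at h

/-- One step of gradient descent with step size `τ`. -/
noncomputable def step (κ ρ τ : ℝ) (x : E) : E := x - τ • P.grad κ ρ x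

lemma norm_step_sub_step_sq_le {κ ρ τ L : ℝ} (hρ : 0 ≤ ρ) (hτ : 0 ≤ τ)
    (hL : ∀ x y, ‖P.grad κ ρ x - P.grad κ ρ y‖ ≤ L * ‖x - y‖) (hτL : τ * L ^ 2 ≤ κ) (x y : E) :
    ‖P.step κ ρ τ x - P.step κ ρ τ y‖ ^ 2 ≤ (1 - τ * κ) * ‖x - y‖ ^ 2 := by
  have e : P.step κ ρ τ x - P.step κ ρ τ y = (x - y) - τ • (P.grad κ ρ x - P.grad κ ρ y) := by
    simp only [step, smul_sub]; abel
  have h1 := P.le_inner_grad_sub_grad (κ := κ) hρ x y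
  have h2 : ‖P.grad κ ρ x - P.grad κ ρ y‖ ^ 2 ≤ L ^ 2 * ‖x - y‖ ^ 2 := by
    rw [← mul_pow]; exact pow_le_pow_left₀ (norm_nonneg _) (hL x y) 2
  rw [e, norm_sub_sq_real, real_inner_smul_right, norm_smul, mul_pow, Real.norm_eq_abs, sq_abs,
    real_inner_comm]
  have h3 := mul_le_mul_of_nonneg_left h1 hτ
  have h4 := mul_le_mul_of_nonneg_left h2 (sq_nonneg τ)
  have h5 := mul_le_mul_of_nonneg_right hτL (mul_nonneg hτ (sq_nonneg ‖x - y‖))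
  nlinarith

lemma exists_grad_eq_zero [CompleteSpace E] {κ ρ : ℝ} (hκ : 0 < κ) (hρ : 0 ≤ ρ) :
    ∃ x, P.grad κ ρ x = 0 := by
  obtain ⟨L, hL⟩ := P.exists_lipschitz_grad hκ.le hρ
  -- With this step size the descent step is a contraction.
  set τ : ℝ := κ / (L ^ 2 + κ ^ 2) with hτ
  have hpos : 0 < L ^ 2 + κ ^ 2 := by positivity
  have hτ0 : 0 < τ := by positivity
  have hτL : τ * L ^ 2 ≤ κ := by
    rw [hτ, div_mul_eq_mul_div, div_le_iff₀ hpos]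
    nlinarith [pow_pos hκ 3]
  have hτκ : τ * κ ≤ 1 := by
    rw [hτ, div_mul_eq_mul_div, div_le_one hpos]
    nlinarith [sq_nonneg L]
  have hc : ContractingWith (Real.toNNReal √(1 - τ * κ)) (P.step κ ρ τ) := by
    constructor
    · rw [Real.toNNReal_lt_one, Real.sqrt_lt' one_pos]
      nlinarith [mul_pos hτ0 hκ]
    · refine LipschitzWith.of_dist_le_mul fun x y => ?_
      rw [dist_eq_norm, dist_eq_norm, Real.coe_toNNReal _ (Real.sqrt_nonneg _)]
      refine le_of_sq_le_sq ?_ (by positivity)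
      rw [mul_pow, Real.sq_sqrt (by linarith)]
      exact P.norm_step_sub_step_sq_le hρ hτ0.le hL hτL x y
  have hfix : P.step κ ρ τ (hc.fixedPoint) = hc.fixedPoint := hc.fixedPoint_isFixedPt
  refine ⟨hc.fixedPoint, ?_⟩
  rw [step, sub_eq_self, smul_eq_zero] at hfix
  exact hfix.resolve_left hτ0.ne'

/-- Gradient descent converges along step sizes `1 / (k + 1)` with `(k + 1)²` steps: the squared
error is at most `(1 - κ / (k + 1)) ^ (k + 1)² ≤ exp (-κ (k + 1))` times the initial one as soon as
the step size is small relative to the Lipschitz constant of the gradient. -/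
lemma tendsto_iterate_step {κ ρ : ℝ} (hκ : 0 < κ) (hρ : 0 ≤ ρ) {z : E} (hz : P.grad κ ρ z = 0) :
    Tendsto (fun k : ℕ => (P.step κ ρ (1 / ((k : ℝ) + 1)))^[(k + 1) ^ 2] 0) atTop (𝓝 z) := by
  obtain ⟨L, hL⟩ := P.exists_lipschitz_grad hκ.le hρ
  have hτ : Tendsto (fun k : ℕ => 1 / ((k : ℝ) + 1)) atTop (𝓝 0) :=
    tendsto_one_div_add_atTop_nhds_zero_nat
  have e1 : ∀ᶠ k : ℕ in atTop, 1 / ((k : ℝ) + 1) * L ^ 2 ≤ κ := by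
    have : Tendsto (fun k : ℕ => 1 / ((k : ℝ) + 1) * L ^ 2) atTop (𝓝 0) := by
      simpa using hτ.mul_const (L ^ 2)
    exact this.eventually_le_const hκ
  have e2 : ∀ᶠ k : ℕ in atTop, 1 / ((k : ℝ) + 1) * κ ≤ 1 := by
    have : Tendsto (fun k : ℕ => 1 / ((k : ℝ) + 1) * κ) atTop (𝓝 0) := by
      simpa using hτ.mul_const κ
    exact this.eventually_le_const one_pos
  have key : ∀ᶠ k : ℕ in atTop,
      ‖(P.step κ ρ (1 / ((k : ℝ) + 1)))^[(k + 1) ^ 2] 0 - z‖ ^ 2 ≤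
        Real.exp (-(κ * ((k : ℝ) + 1))) * ‖z‖ ^ 2 := by
    filter_upwards [e1, e2] with k h1 h2
    set τ : ℝ := 1 / ((k : ℝ) + 1) with hτk
    have hτ0 : 0 ≤ τ := by positivity
    have hfix : P.step κ ρ τ z = z := by rw [step, hz, smul_zero, sub_zero]
    have hT : ∀ T : ℕ, ‖(P.step κ ρ τ)^[T] 0 - z‖ ^ 2 ≤ (1 - τ * κ) ^ T * ‖z‖ ^ 2 := by
      intro T
      induction T with
      | zero => simp
      | succ T ih =>
        rw [Function.iterate_succ_apply', pow_succ' (1 - τ * κ), mul_assoc]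
        have h3 := P.norm_step_sub_step_sq_le hρ hτ0 hL h1 ((P.step κ ρ τ)^[T] 0) z
        rw [hfix] at h3
        have h4 := mul_le_mul_of_nonneg_left ih (sub_nonneg.2 h2)
        exact h3.trans h4
    refine (hT _).trans (mul_le_mul_of_nonneg_right ?_ (sq_nonneg _))
    calc (1 - τ * κ) ^ (k + 1) ^ 2 ≤ Real.exp (-(τ * κ)) ^ (k + 1) ^ 2 :=
          pow_le_pow_left₀ (sub_nonneg.2 h2) (Real.one_sub_le_exp_neg _) _
      _ = Real.exp (-(κ * ((k : ℝ) + 1))) := by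
          rw [← Real.exp_nat_mul]
          congr 1
          rw [hτk]
          push_cast
          field_simp
  have hexp : Tendsto (fun k : ℕ => Real.exp (-(κ * ((k : ℝ) + 1))) * ‖z‖ ^ 2) atTop (𝓝 0) := by
    have h1 : Tendsto (fun k : ℕ => κ * ((k : ℝ) + 1)) atTop atTop :=
      (tendsto_atTop_add_const_right _ _ tendsto_natCast_atTop_atTop).const_mul_atTop hκ
    simpa using (Real.tendsto_exp_neg_atTop_nhds_zero.comp h1).mul_const (‖z‖ ^ 2)
  have hsq := squeeze_zero' (Eventually.of_forall fun k => sq_nonneg _) key hexp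
  rw [tendsto_iff_norm_sub_tendsto_zero]
  simpa [Real.sqrt_sq (norm_nonneg _)] using hsq.sqrt

end Gradient

/-! ### Limit of growing penalties -/

section Limits

variable [Fintype ι]

lemma isMin_of_tendsto_penalized {P : IntervalQP E ι} {κ : ℝ} (hκ : 0 < κ) {x : ℕ → E}
    (hx : ∀ k : ℕ, P.grad κ k (x k) = 0) (hne : P.feasible.Nonempty) {φ : ℕ → ℕ}
    (hφ : StrictMono φ) {y : E} (hy : Tendsto (x ∘ φ) atTop (𝓝 y)) : P.IsMin κ y := by
  have hle : ∀ k, ∀ w ∈ P.feasible, P.obj κ (x k) + k / 2 * P.violation (x k) ≤ P.obj κ w :=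
    fun k w hw => obj_add_violation_le_of_grad_eq_zero hκ.le (Nat.cast_nonneg k) (hx k) hw
  have hobj : Tendsto (fun k => P.obj κ (x (φ k))) atTop (𝓝 (P.obj κ y)) :=
    ((P.continuous_obj κ).tendsto y).comp hy
  have hvio : Tendsto (fun k => P.violation (x (φ k))) atTop (𝓝 (P.violation y)) :=
    (P.continuous_violation.tendsto y).comp hy
  refine ⟨?_, fun w hw => ?_⟩
  · obtain ⟨w, hw⟩ := hne
    rw [← P.violation_eq_zero_iff]
    refine le_antisymm ?_ (P.violation_nonneg y)
    have hφ' : Tendsto (fun k => (φ k : ℝ)) atTop atTop :=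
      tendsto_natCast_atTop_atTop.comp hφ.tendsto_atTop
    have h2 : Tendsto (fun k => 2 * (P.obj κ w - P.obj κ (x (φ k))) / (φ k : ℝ)) atTop (𝓝 0) :=
      ((hobj.const_sub _).const_mul 2).div_atTop hφ'
    refine le_of_tendsto_of_tendsto hvio h2 ?_
    filter_upwards [hφ'.eventually_gt_atTop 0] with k hk
    rw [le_div_iff₀ hk]
    linarith [hle (φ k) w hw]
  · refine le_of_tendsto hobj (Eventually.of_forall fun k => ?_)
    have h1 := hle (φ k) w hw
    have h2 : 0 ≤ (φ k : ℝ) / 2 * P.violation (x (φ k)) :=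
      mul_nonneg (by positivity) (P.violation_nonneg _)
    linarith

lemma exists_norm_le_of_grad_eq_zero {P : IntervalQP E ι} {κ : ℝ} (hκ : 0 < κ) {x : ℕ → E}
    (hx : ∀ k : ℕ, P.grad κ k (x k) = 0) (hne : P.feasible.Nonempty) : ∃ C, ∀ k, ‖x k‖ ≤ C := by
  obtain ⟨w, hw⟩ := hne
  obtain ⟨C, hC⟩ := P.exists_norm_le_of_obj_le hκ (P.obj κ w)
  refine ⟨C, fun k => hC _ ?_⟩
  have h1 := obj_add_violation_le_of_grad_eq_zero hκ.le (Nat.cast_nonneg k) (hx k) hw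
  have h2 : 0 ≤ (k : ℝ) / 2 * P.violation (x k) :=
    mul_nonneg (by positivity) (P.violation_nonneg _)
  linarith

lemma exists_isMin [FiniteDimensional ℝ E] {κ : ℝ} (hκ : 0 < κ) (hne : P.feasible.Nonempty) :
    ∃ x, P.IsMin κ x := by
  have := FiniteDimensional.complete ℝ E
  have := FiniteDimensional.proper ℝ E
  choose x hx using fun k : ℕ => P.exists_grad_eq_zero hκ (Nat.cast_nonneg k)
  obtain ⟨C, hC⟩ := exists_norm_le_of_grad_eq_zero hκ hx hne
  obtain ⟨y, -, φ, hφ, hy⟩ := (isCompact_closedBall (0 : E) C).tendsto_subseq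
    (x := x) fun k => by simpa using hC k
  exact ⟨y, isMin_of_tendsto_penalized hκ hx hne hφ hy⟩

/-- As the penalty parameter grows, the minimizers of the penalized regularized problem tend to the
minimizer of the regularized problem. -/
lemma tendsto_penalized [FiniteDimensional ℝ E] {P : IntervalQP E ι} {κ : ℝ} (hκ : 0 < κ)
    {x : ℕ → E} (hx : ∀ k : ℕ, P.grad κ k (x k) = 0) {z : E} (hz : P.IsMin κ z) :
    Tendsto x atTop (𝓝 z) := by
  have := FiniteDimensional.proper ℝ E
  obtain ⟨C, hC⟩ := exists_norm_le_of_grad_eq_zero hκ hx ⟨z, hz.1⟩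
  exact tendsto_of_bounded_of_unique_subseq_limit hC fun φ hφ y hy =>
    (isMin_of_tendsto_penalized hκ hx ⟨z, hz.1⟩ hφ hy).unique hκ hz

end Limits

/-! ### Vanishing regularization limit -/

section Tikhonov

/-- The regularized minimizers stay bounded as the regularization vanishes, provided that the
objective is bounded below. Otherwise some subsequence of `x k / ‖x k‖` tends to a unit recession
direction `d` of the feasible set with `Q d = 0` and `0 ≤ ⟪c, d⟫`. Then `x k - d` is feasible for
large `k`, has no larger objective value and is shorter than `x k`, a contradiction. -/
lemma exists_norm_le_of_isMin [FiniteDimensional ℝ E] [Finite ι] {P : IntervalQP E ι} {r : ℝ}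
    (hr : ∀ y ∈ P.feasible, r ≤ P.obj 0 y)
    {x : ℕ → E} (hx : ∀ k : ℕ, P.IsMin (1 / ((k : ℝ) + 1)) (x k)) : ∃ C, ∀ k, ‖x k‖ ≤ C := by
  have := FiniteDimensional.proper ℝ E
  by_contra! hunb
  choose K hK using fun j : ℕ => hunb ((j : ℝ) + 1)
  have hKpos : ∀ j, 0 < ‖x (K j)‖ := fun j => lt_of_le_of_lt (by positivity) (hK j)
  obtain ⟨d, hd, φ, hφ, hlim⟩ := (isCompact_sphere (0 : E) 1).tendsto_subseq
    (x := fun j => ‖x (K j)‖⁻¹ • x (K j)) fun j => by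
      simp [norm_smul, (hKpos j).ne']
  have hd1 : ‖d‖ = 1 := by simpa using hd
  set k : ℕ → ℕ := fun j => K (φ j) with hk
  set R : ℕ → ℝ := fun j => ‖x (k j)‖ with hR
  have hRpos : ∀ j, 0 < R j := fun j => hKpos (φ j)
  have hRtop : Tendsto R atTop atTop := by
    refine tendsto_atTop_mono (f := fun j : ℕ => (j : ℝ)) (fun j => ?_)
      tendsto_natCast_atTop_atTop
    have h1 : (j : ℝ) ≤ φ j := by exact_mod_cast hφ.id_le j
    have h2 := hK (φ j)
    simp only [hR, hk]
    linarith
  have hdir : Tendsto (fun j => (R j)⁻¹ • x (k j)) atTop (𝓝 d) := hlim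
  have hinner : ∀ w : E, Tendsto (fun j => ⟪w, x (k j)⟫ / R j) atTop (𝓝 ⟪w, d⟫) := fun w => by
    have h1 : Tendsto (fun j => ⟪w, (R j)⁻¹ • x (k j)⟫) atTop (𝓝 ⟪w, d⟫) :=
      tendsto_const_nhds.inner hdir
    refine h1.congr fun j => ?_
    rw [real_inner_smul_right, div_eq_inv_mul]
  have hfeas : ∀ j i, ⟪P.a i, x (k j)⟫ ∈ P.S i := fun j => (hx (k j)).1
  have hray : ∀ t : ℝ, 0 ≤ t → x 0 + t • d ∈ P.feasible := fun t ht i => by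
    rw [inner_add_right, real_inner_smul_right]
    exact (P.residual i).ordConnected.add_mul_mem_of_tendsto_div (fun j => hfeas j i) hRtop
      (hinner _) ((hx 0).1 i) ht
  have hback : ∀ᶠ j in atTop, x (k j) - d ∈ P.feasible := by
    have : ∀ᶠ j in atTop, ∀ i, ⟪P.a i, x (k j)⟫ - ⟪P.a i, d⟫ ∈ P.S i :=
      eventually_all.2 fun i => (P.residual i).ordConnected.eventually_sub_mem_of_tendsto_div
        (fun j => hfeas j i) hRtop (hinner _)
    filter_upwards [this] with j hj i
    rw [inner_sub_right]
    exact hj i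
  -- Comparison with `x 0` bounds the objective values, which forces `⟪Q d, d⟫ ≤ 0`.
  have hQd0 : ⟪P.Q d, d⟫ = 0 := by
    refine le_antisymm ?_ (P.inner_Q_nonneg d)
    have hle : ∀ j, P.obj 0 (x (k j)) ≤ P.obj 0 (x 0) + 1 / 2 * ‖x 0‖ ^ 2 := fun j => by
      have h1 := (hx (k j)).2 _ (hx 0).1
      rw [P.obj_eq_obj_zero_add, P.obj_eq_obj_zero_add _ (x 0)] at h1
      have h2 : 1 / ((k j : ℝ) + 1) ≤ 1 := by
        rw [div_le_one (by positivity)]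
        linarith [(Nat.cast_nonneg (k j) : (0 : ℝ) ≤ k j)]
      have h3 : 0 ≤ 1 / ((k j : ℝ) + 1) / 2 * ‖x (k j)‖ ^ 2 := by positivity
      nlinarith [sq_nonneg ‖x 0‖]
    have hlhs : Tendsto (fun j => ⟪P.Q ((R j)⁻¹ • x (k j)), (R j)⁻¹ • x (k j)⟫ / 2) atTop
        (𝓝 (⟪P.Q d, d⟫ / 2)) :=
      (((P.Q.continuous.tendsto d).comp hdir).inner hdir).div_const 2
    have hrhs : Tendsto (fun j => (P.obj 0 (x 0) + 1 / 2 * ‖x 0‖ ^ 2) / R j / R j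
        - ⟪P.c, x (k j)⟫ / R j / R j) atTop (𝓝 0) := by
      simpa using ((tendsto_const_nhds.div_atTop hRtop).div_atTop hRtop).sub
        ((hinner P.c).div_atTop hRtop)
    have := le_of_tendsto_of_tendsto' hlhs hrhs fun j => by
      have h1 := hle j
      rw [obj, zero_div, zero_mul, add_zero] at h1
      rw [map_smul, real_inner_smul_left, real_inner_smul_right, ← sub_div, ← sub_div, div_div,
        le_div_iff₀ (mul_pos (hRpos j) (hRpos j))]
      have h2 : (R j)⁻¹ * ((R j)⁻¹ * ⟪P.Q (x (k j)), x (k j)⟫) / 2 * (R j * R j)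
          = ⟪P.Q (x (k j)), x (k j)⟫ / 2 := by
        have := (hRpos j).ne'
        field_simp
      rw [h2]
      linarith
    linarith
  have hQd : P.Q d = 0 := by
    -- A vector at which a positive semidefinite form vanishes lies in its kernel.
    have h1 : ∀ t : ℝ, 0 ≤ ⟪P.Q (P.Q d), P.Q d⟫ * t ^ 2 + 2 * ‖P.Q d‖ ^ 2 * t := fun t => by
      have h := P.inner_Q_nonneg (d + t • P.Q d)
      simp only [map_add, map_smul, inner_add_left, inner_add_right, real_inner_smul_left,
        real_inner_smul_right] at h
      rw [hQd0, P.inner_Q_comm (P.Q d) d, real_inner_self_eq_norm_sq] at h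
      linarith
    set b := ⟪P.Q (P.Q d), P.Q d⟫ with hb
    have hb0 : 0 ≤ b := P.inner_Q_nonneg _
    have h2 := h1 (-(‖P.Q d‖ ^ 2 / (b + 1)))
    have h3 : 0 < b + 1 := by linarith
    have h4 : b * (-(‖P.Q d‖ ^ 2 / (b + 1))) ^ 2 + 2 * ‖P.Q d‖ ^ 2 * -(‖P.Q d‖ ^ 2 / (b + 1)) =
        -((b + 2) * (‖P.Q d‖ ^ 2) ^ 2 / (b + 1) ^ 2) := by
      field_simp
      ring
    rw [h4, neg_nonneg, div_le_iff₀ (by positivity), zero_mul] at h2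
    have h5 : (‖P.Q d‖ ^ 2) ^ 2 = 0 := le_antisymm (by nlinarith) (by positivity)
    simpa using h5
  have hobj : ∀ (y : E) (t : ℝ), P.obj 0 (y + t • d) = P.obj 0 y + t * ⟪P.c, d⟫ := fun y t => by
    rw [P.obj_add_smul, P.inner_Q_comm y d, hQd]
    simp
  have hcd : 0 ≤ ⟪P.c, d⟫ := by
    by_contra! hneg
    have h1 := hr _ (hray ((P.obj 0 (x 0) - r + 1) / (-⟪P.c, d⟫))
      (div_nonneg (by linarith [hr _ (hx 0).1]) (by linarith)))
    rw [hobj] at h1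
    have h2 : (P.obj 0 (x 0) - r + 1) / (-⟪P.c, d⟫) * ⟪P.c, d⟫ = -(P.obj 0 (x 0) - r + 1) := by
      have := hneg.ne
      field_simp
    linarith
  have hshort : ∀ᶠ j in atTop, 1 / 2 < ⟪d, x (k j)⟫ / R j := by
    have := hinner d
    rw [real_inner_self_eq_norm_sq, hd1] at this
    exact this.eventually_const_lt (by norm_num)
  obtain ⟨j, hj1, hj2, hj3⟩ :=
    (hback.and (hshort.and (hRtop.eventually_ge_atTop 1))).exists
  have h1 := (hx (k j)).2 _ hj1
  rw [P.obj_eq_obj_zero_add, P.obj_eq_obj_zero_add _ (x (k j) - d),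
    show x (k j) - d = x (k j) + (-1 : ℝ) • d by module, hobj] at h1
  have hκ : 0 < 1 / ((k j : ℝ) + 1) / 2 := by positivity
  have h2 : ‖x (k j)‖ ^ 2 ≤ ‖x (k j) + (-1 : ℝ) • d‖ ^ 2 :=
    le_of_mul_le_mul_left (by linarith) hκ
  rw [norm_add_sq_real, real_inner_smul_right, norm_smul, hd1, real_inner_comm] at h2
  rw [lt_div_iff₀ (hRpos j)] at hj2
  norm_num at h2
  linarith

lemma isMinNormMin_of_tendsto_isMin {P : IntervalQP E ι} {x : ℕ → E}
    (hx : ∀ k : ℕ, P.IsMin (1 / ((k : ℝ) + 1)) (x k)) {φ : ℕ → ℕ} (hφ : StrictMono φ) {y : E}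
    (hy : Tendsto (x ∘ φ) atTop (𝓝 y)) : P.IsMinNormMin y := by
  have hκ : Tendsto (fun j => 1 / ((φ j : ℝ) + 1)) atTop (𝓝 0) :=
    tendsto_one_div_add_atTop_nhds_zero_nat.comp hφ.tendsto_atTop
  refine ⟨⟨P.isClosed_feasible.mem_of_tendsto hy (Eventually.of_forall fun j => (hx _).1),
    fun w hw => ?_⟩, fun w hw => ?_⟩
  · have h1 : Tendsto (fun j => P.obj 0 w + 1 / ((φ j : ℝ) + 1) / 2 * ‖w‖ ^ 2) atTop
        (𝓝 (P.obj 0 w)) := by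
      simpa using ((hκ.div_const 2).mul_const (‖w‖ ^ 2)).const_add (P.obj 0 w)
    refine le_of_tendsto_of_tendsto' (((P.continuous_obj 0).tendsto y).comp hy) h1 fun j => ?_
    have h2 := (hx (φ j)).2 w hw
    rw [P.obj_eq_obj_zero_add, P.obj_eq_obj_zero_add _ w] at h2
    have h3 : 0 ≤ 1 / ((φ j : ℝ) + 1) / 2 * ‖x (φ j)‖ ^ 2 := by positivity
    simp only [Function.comp_apply]
    linarith
  · refine le_of_tendsto hy.norm (Eventually.of_forall fun j => ?_)
    have h2 := (hx (φ j)).2 w hw.1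
    rw [P.obj_eq_obj_zero_add, P.obj_eq_obj_zero_add _ w] at h2
    have h3 := hw.2 _ (hx (φ j)).1
    have h4 : 0 < 1 / ((φ j : ℝ) + 1) / 2 := by positivity
    have h5 : ‖x (φ j)‖ ^ 2 ≤ ‖w‖ ^ 2 := le_of_mul_le_mul_left (by linarith) h4
    exact le_of_sq_le_sq h5 (norm_nonneg w)

/-- A feasible convex quadratic program whose objective is bounded below has a minimizer, and one of
smallest norm. -/
theorem exists_isMinNormMin [FiniteDimensional ℝ E] [Finite ι] {P : IntervalQP E ι}
    (hne : P.feasible.Nonempty) {r : ℝ} (hr : ∀ y ∈ P.feasible, r ≤ P.obj 0 y) :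
    ∃ x, P.IsMinNormMin x := by
  have := FiniteDimensional.proper ℝ E
  have := Fintype.ofFinite ι
  choose x hx using fun k : ℕ =>
    P.exists_isMin (κ := 1 / ((k : ℝ) + 1)) (by positivity) hne
  obtain ⟨C, hC⟩ := exists_norm_le_of_isMin hr hx
  obtain ⟨y, -, φ, hφ, hy⟩ := (isCompact_closedBall (0 : E) C).tendsto_subseq
    (x := x) fun k => by simpa using hC k
  exact ⟨y, isMinNormMin_of_tendsto_isMin hx hφ hy⟩

/-- As the regularization vanishes, the regularized minimizers tend to the minimizer of smallest
norm. -/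
theorem tendsto_isMinNormMin [FiniteDimensional ℝ E] [Finite ι] {P : IntervalQP E ι} {x : ℕ → E}
    (hx : ∀ k : ℕ, P.IsMin (1 / ((k : ℝ) + 1)) (x k)) {z : E} (hz : P.IsMinNormMin z) :
    Tendsto x atTop (𝓝 z) := by
  have := FiniteDimensional.proper ℝ E
  obtain ⟨C, hC⟩ := exists_norm_le_of_isMin hz.1.2 hx
  exact tendsto_of_bounded_of_unique_subseq_limit hC fun φ hφ y hy =>
    (isMinNormMin_of_tendsto_isMin hx hφ hy).unique hz

end Tikhonov

end IntervalQP

/-! ### Residuals of the constraints of an LCQP -/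

namespace ConstraintSense

/-- `1` if the constraint bounds the left-hand side from above, `0` otherwise. -/
def upperFlag : ConstraintSense → ℝ
  | le => 1
  | eq => 1
  | ge => 0

/-- `1` if the constraint bounds the left-hand side from below, `0` otherwise. -/
def lowerFlag : ConstraintSense → ℝ
  | le => 0
  | eq => 1
  | ge => 1

/-- The signed violation of the constraint `s ∘ β`. -/
noncomputable def residual (o : ConstraintSense) (β s : ℝ) : ℝ :=
  o.upperFlag * max (s - β) 0 - o.lowerFlag * max (β - s) 0

lemma isResidual (o : ConstraintSense) (β : ℝ) :
    IsResidual {s | o.holds s β} (o.residual β) := by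
  intro s
  cases o
  all_goals
    simp only [residual, upperFlag, lowerFlag, holds, Set.mem_ofPred_eq]
    rcases le_total s β with h | h
    · rw [max_eq_right (by linarith), max_eq_left (by linarith)]
      refine ⟨by linarith, fun q hq => by nlinarith⟩
    · rw [max_eq_left (by linarith), max_eq_right (by linarith)]
      refine ⟨by linarith, fun q hq => by nlinarith⟩

end ConstraintSense

/-- `1` for a finite bound, `0` for an infinite one. -/
def boundFlag : ℝ ⊕ Unit → ℝ := Sum.elim (fun _ => 1) fun _ => 0

/-- The value of a finite bound, and `0` for an infinite one. -/
def boundValue : ℝ ⊕ Unit → ℝ := Sum.elim id fun _ => 0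

lemma continuous_boundFlag : Continuous boundFlag := by
  unfold boundFlag
  exact continuous_const.sumElim continuous_const

lemma continuous_boundValue : Continuous boundValue := by
  unfold boundValue
  exact continuous_id.sumElim continuous_const

/-- The signed violation of a lower bound. -/
noncomputable def LowerBound.residual (a : LowerBound) (s : ℝ) : ℝ :=
  -(boundFlag a * max (boundValue a - s) 0)

/-- The signed violation of an upper bound. -/
noncomputable def UpperBound.residual (a : UpperBound) (s : ℝ) : ℝ :=
  boundFlag a * max (s - boundValue a) 0

lemma LowerBound.isResidual (a : LowerBound) :
    IsResidual {s | LowerBound.holds a s} (LowerBound.residual a) := by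
  intro s
  rcases a with a | a
  · simp only [residual, boundFlag, boundValue, holds, Set.mem_ofPred_eq, Sum.elim_inl, id]
    rcases le_total s a with h | h
    · rw [max_eq_left (by linarith)]
      exact ⟨by linarith, fun q hq => by nlinarith⟩
    · rw [max_eq_right (by linarith)]
      exact ⟨by linarith, fun q hq => by linarith⟩
  · simp [residual, boundFlag, holds]

lemma UpperBound.isResidual (a : UpperBound) :
    IsResidual {s | UpperBound.holds a s} (UpperBound.residual a) := by
  intro s
  rcases a with a | a
  · simp only [residual, boundFlag, boundValue, holds, Set.mem_ofPred_eq, Sum.elim_inl, id]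
    rcases le_total s a with h | h
    · rw [max_eq_right (by linarith)]
      exact ⟨by linarith, fun q hq => by linarith⟩
    · rw [max_eq_left (by linarith)]
      exact ⟨by linarith, fun q hq => by nlinarith⟩
  · simp [residual, boundFlag, holds]

/-! ### LCQPs as quadratic programs with interval constraints -/

namespace LCQPGraph

variable {m n : ℕ}

/-- The LCQP as a quadratic program on Euclidean space. Linear constraints, lower bounds and upper
bounds are kept separate, so that every single constraint describes a nonempty interval even if the
problem is infeasible. -/
noncomputable def toIntervalQP (G : LCQPGraph m n) :
    IntervalQP (EuclideanSpace ℝ (Fin n)) (Fin m ⊕ Fin n ⊕ Fin n) where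
  Q := Matrix.toEuclideanCLM (𝕜 := ℝ) G.Q
  isPositive := (ContinuousLinearMap.isPositive_toLinearMap_iff _).1
    (Matrix.isPositive_toEuclideanLin_iff.2 G.posSemidef)
  c := WithLp.toLp 2 G.c
  a := Sum.elim (fun i => WithLp.toLp 2 (G.A i))
    (Sum.elim (fun j => EuclideanSpace.single j 1) fun j => EuclideanSpace.single j 1)
  S := Sum.elim (fun i => {s | (G.sense i).holds s (G.b i)})
    (Sum.elim (fun j => {s | LowerBound.holds (G.l j) s}) fun j => {s | UpperBound.holds (G.u j) s})
  v := Sum.elim (fun i => (G.sense i).residual (G.b i))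
    (Sum.elim (fun j => LowerBound.residual (G.l j)) fun j => UpperBound.residual (G.u j))
  residual := by
    rintro (i | j | j)
    exacts [(G.sense i).isResidual _, LowerBound.isResidual _, UpperBound.isResidual _]

lemma toIntervalQP_Q_apply (G : LCQPGraph m n) (x : EuclideanSpace ℝ (Fin n)) (j : Fin n) :
    G.toIntervalQP.Q x j = ∑ j', G.Q j j' * x j' := by
  simp [toIntervalQP, Matrix.mulVec, dotProduct]

lemma inner_toLp_eq_sum (y : Fin n → ℝ) (x : EuclideanSpace ℝ (Fin n)) :
    ⟪WithLp.toLp 2 y, x⟫ = ∑ j, y j * x j := by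
  simp [PiLp.inner_apply, mul_comm]

lemma inner_single_one (j : Fin n) (x : EuclideanSpace ℝ (Fin n)) :
    ⟪EuclideanSpace.single j (1 : ℝ), x⟫ = x j := by
  simp [EuclideanSpace.inner_single_left]

lemma mem_feasible_toIntervalQP {G : LCQPGraph m n} {x : EuclideanSpace ℝ (Fin n)} :
    x ∈ G.toIntervalQP.feasible ↔ G.IsFeasible x := by
  simp [IntervalQP.feasible, toIntervalQP, IsFeasible, inner_toLp_eq_sum,
    inner_single_one]

lemma toIntervalQP_obj_zero (G : LCQPGraph m n) (x : EuclideanSpace ℝ (Fin n)) :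
    G.toIntervalQP.obj 0 x = G.objective x := by
  have h1 : ⟪G.toIntervalQP.Q x, x⟫ = ∑ j, ∑ j', x j * G.Q j j' * x j' := by
    rw [PiLp.inner_apply]
    refine Finset.sum_congr rfl fun j _ => ?_
    rw [toIntervalQP_Q_apply]
    simp [Finset.mul_sum, mul_assoc]
  have h2 : ⟪G.toIntervalQP.c, x⟫ = ∑ j, G.c j * x j := inner_toLp_eq_sum _ _
  rw [IntervalQP.obj, h1, h2, objective]
  ring

lemma isMin_toIntervalQP {G : LCQPGraph m n} {x : EuclideanSpace ℝ (Fin n)} :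
    G.toIntervalQP.IsMin 0 x ↔ G.IsOptimal x := by
  simp only [IntervalQP.IsMin, IsOptimal, mem_feasible_toIntervalQP, toIntervalQP_obj_zero]

lemma isMinNormMin_toIntervalQP {G : LCQPGraph m n} {x : EuclideanSpace ℝ (Fin n)} :
    G.toIntervalQP.IsMinNormMin x ↔ G.IsMinNormOptimal x := by
  simp only [IntervalQP.IsMinNormMin, IsMinNormOptimal, isMin_toIntervalQP]

lemma FeasibleBounded.exists_isFeasible {G : LCQPGraph m n} (hG : G.FeasibleBounded) :
    ∃ x, G.IsFeasible x := by
  obtain ⟨r, hr⟩ := hG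
  by_contra! h
  simp [optValue, h] at hr

lemma FeasibleBounded.exists_le_objective {G : LCQPGraph m n} (hG : G.FeasibleBounded) :
    ∃ r, ∀ x, G.IsFeasible x → r ≤ G.objective x := by
  obtain ⟨r, hr⟩ := hG
  refine ⟨r, fun x hx => ?_⟩
  rw [← EReal.coe_le_coe_iff, ← hr]
  exact iInf₂_le x hx

theorem FeasibleBounded.existsUnique_isMinNormOptimal {G : LCQPGraph m n}
    (hG : G.FeasibleBounded) : ∃! x, G.IsMinNormOptimal x := by
  obtain ⟨y, hy⟩ := hG.exists_isFeasible
  obtain ⟨r, hr⟩ := hG.exists_le_objective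
  obtain ⟨x, hx⟩ := IntervalQP.exists_isMinNormMin (P := G.toIntervalQP)
    ⟨y, mem_feasible_toIntervalQP.2 hy⟩ (r := r) fun z hz => by
      rw [toIntervalQP_obj_zero]
      exact hr z (mem_feasible_toIntervalQP.1 hz)
  exact ⟨x, isMinNormMin_toIntervalQP.1 hx, fun z hz =>
    (isMinNormMin_toIntervalQP.2 hz).unique hx⟩

lemma FeasibleBounded.isMinNormOptimal_sol {G : LCQPGraph m n} (hG : G.FeasibleBounded) :
    G.IsMinNormOptimal G.sol := by
  have h := hG.existsUnique_isMinNormOptimal.exists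
  rw [sol, dif_pos h]
  exact h.choose_spec

/-- A coordinate of the gradient is a sum of local terms and of messages along the edges. -/
lemma toIntervalQP_grad_apply (G : LCQPGraph m n) (κ ρ : ℝ) (x : EuclideanSpace ℝ (Fin n))
    (j : Fin n) :
    G.toIntervalQP.grad κ ρ x j = ∑ j', G.Q j j' * x j' + G.c j + κ * x j +
      ρ * (∑ i, G.A i j * (G.sense i).residual (G.b i) (∑ j', G.A i j' * x j') +
        LowerBound.residual (G.l j) (x j) + UpperBound.residual (G.u j) (x j)) := by
  rw [IntervalQP.grad, PiLp.add_apply, PiLp.add_apply, PiLp.add_apply, toIntervalQP_Q_apply]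
  simp [toIntervalQP, inner_toLp_eq_sum, inner_single_one, Pi.single_apply, mul_comm, mul_add,
    add_assoc]

end LCQPGraph

/-! ### Message passing simulates gradient descent -/

namespace MessagePassing

/-- The initial features: `(b, upper flag, lower flag)` for a constraint node, and
`(0, c, lower value, lower flag, upper value, upper flag)` for a variable node. -/
noncomputable def descentInit : MessagePassing 3 6 :=
  embed ⟨fun z => ![z.1, z.2.upperFlag, z.2.lowerFlag], by
      have h1 : Continuous ConstraintSense.upperFlag := continuous_of_discreteTopology
      have h2 : Continuous ConstraintSense.lowerFlag := continuous_of_discreteTopology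
      fun_prop⟩
    ⟨fun z => ![0, z.1, boundValue z.2.1, boundFlag z.2.1, boundValue z.2.2, boundFlag z.2.2], by
      have h1 := continuous_boundValue
      have h2 := continuous_boundFlag
      fun_prop⟩

/-- Two layers that perform one step of gradient descent. In the first one the constraint nodes
compute the signed violations of their constraints, in the second one these are sent back to the
variable nodes, which update their iterate (the feature `0`). -/
noncomputable def descentStep (κ ρ τ : ℝ) (N : MessagePassing 3 6) : MessagePassing 3 6 :=
  layer (p := 4) (q := 6) (dV := 1) (dW := 0) (dQ := 1)
    (layer (p := 3) (q := 6) (dV := 0) (dW := 1) (dQ := 0) N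
      ⟨fun _ => 0, by fun_prop⟩
      ⟨fun t => ![t 0], by fun_prop⟩
      ⟨fun _ => 0, by fun_prop⟩
      ⟨fun z => ![z.1 0, z.1 1, z.1 2,
        z.1 1 * max (z.2 0 - z.1 0) 0 - z.1 2 * max (z.1 0 - z.2 0) 0], by fun_prop⟩
      ⟨fun z => z.1, by fun_prop⟩)
    ⟨fun s => ![s 3], by fun_prop⟩
    ⟨fun _ => 0, by fun_prop⟩
    ⟨fun t => ![t 0], by fun_prop⟩
    ⟨fun z => ![z.1 0, z.1 1, z.1 2], by fun_prop⟩
    ⟨fun z => ![z.1 0 - τ * (z.2.2 0 + z.1 1 + κ * z.1 0 +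
        ρ * (z.2.1 0 + -(z.1 3 * max (z.1 2 - z.1 0) 0) + z.1 5 * max (z.1 0 - z.1 4) 0)),
        z.1 1, z.1 2, z.1 3, z.1 4, z.1 5], by fun_prop⟩

lemma features_iterate_descentStep {m n : ℕ} (G : LCQPGraph m n) (κ ρ τ : ℝ) (T : ℕ) :
    features G ((descentStep κ ρ τ)^[T] descentInit) =
      (fun i => ![G.b i, (G.sense i).upperFlag, (G.sense i).lowerFlag],
       fun j => ![(G.toIntervalQP.step κ ρ τ)^[T] 0 j, G.c j, boundValue (G.l j),
        boundFlag (G.l j), boundValue (G.u j), boundFlag (G.u j)]) := by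
  induction T with
  | zero => simp [descentInit, features]
  | succ T ih =>
    rw [Function.iterate_succ_apply', Function.iterate_succ_apply']
    set x := (G.toIntervalQP.step κ ρ τ)^[T] 0
    rw [descentStep, features, features, ih]
    refine Prod.ext (funext fun i => ?_) (funext fun j => ?_)
    · simp
    · have h : G.toIntervalQP.step κ ρ τ x j = x j - τ * G.toIntervalQP.grad κ ρ x j := by
        simp [IntervalQP.step]
      have hA : ∀ i, (∑ j', G.A i j' • ![x j']) 0 = ∑ j', G.A i j' * x j' := by simp
      change ![x j - τ * ((∑ j', G.Q j j' • ![x j']) 0 + G.c j + κ * x j +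
        ρ * ((∑ i, G.A i j • ![(G.sense i).residual (G.b i) ((∑ j', G.A i j' • ![x j']) 0)]) 0 +
          LowerBound.residual (G.l j) (x j) + UpperBound.residual (G.u j) (x j))),
        G.c j, boundValue (G.l j), boundFlag (G.l j), boundValue (G.u j), boundFlag (G.u j)] = _
      simp only [h, G.toIntervalQP_grad_apply, hA]
      simp

lemma continuous_features {m n p q : ℕ} (N : MessagePassing p q) :
    (∀ i, Continuous fun G : LCQPGraph m n => (features G N).1 i) ∧
      ∀ j, Continuous fun G : LCQPGraph m n => (features G N).2 j := by
  have hG : Continuous (LCQPGraph.toProd : LCQPGraph m n → _) := continuous_induced_dom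
  have hA : Continuous fun G : LCQPGraph m n => G.A := hG.fst
  have hb : Continuous fun G : LCQPGraph m n => G.b := hG.snd.fst
  have hc : Continuous fun G : LCQPGraph m n => G.c := hG.snd.snd.fst
  have hQ : Continuous fun G : LCQPGraph m n => G.Q := hG.snd.snd.snd.fst
  have hl : Continuous fun G : LCQPGraph m n => G.l := hG.snd.snd.snd.snd.fst
  have hu : Continuous fun G : LCQPGraph m n => G.u := hG.snd.snd.snd.snd.snd.fst
  have hs : Continuous fun G : LCQPGraph m n => G.sense := hG.snd.snd.snd.snd.snd.snd
  have hA' : ∀ i j, Continuous fun G : LCQPGraph m n => G.A i j := fun i j => hA.matrix_elem i j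
  have hQ' : ∀ i j, Continuous fun G : LCQPGraph m n => G.Q i j := fun i j => hQ.matrix_elem i j
  induction N with
  | embed fV fW =>
    exact ⟨fun i => fV.continuous.comp
        (((continuous_apply i).comp hb).prodMk ((continuous_apply i).comp hs)),
      fun j => fW.continuous.comp (((continuous_apply j).comp hc).prodMk
        (((continuous_apply j).comp hl).prodMk ((continuous_apply j).comp hu)))⟩
  | layer N gV gW gQ fV fW ih =>
    obtain ⟨h1, h2⟩ := ih
    exact ⟨fun i => fV.continuous.comp ((h1 i).prodMk
        (continuous_finsetSum _ fun j _ => (hA' i j).smul (gW.continuous.comp (h2 j)))),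
      fun j => fW.continuous.comp ((h2 j).prodMk
        ((continuous_finsetSum _ fun i _ => (hA' i j).smul (gV.continuous.comp (h1 i))).prodMk
          (continuous_finsetSum _ fun j' _ => (hQ' j j').smul (gQ.continuous.comp (h2 j')))))⟩

end MessagePassing

namespace NodeGNN

lemma continuous_eval {m n : ℕ} (F : NodeGNN) :
    Continuous fun G : LCQPGraph m n => F.eval G := by
  obtain ⟨h1, h2⟩ := F.layers.continuous_features (m := m) (n := n)
  refine (PiLp.continuous_toLp 2 _).comp (continuous_pi fun j => ?_)
  exact F.r.continuous.comp ((continuous_finsetSum _ fun i _ => h1 i).prodMk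
    ((continuous_finsetSum _ fun j' _ => h2 j').prodMk (h2 j)))

/-- The GNN that performs `T` steps of gradient descent and returns the iterate. -/
noncomputable def descent (κ ρ τ : ℝ) (T : ℕ) : NodeGNN where
  p := 3
  q := 6
  layers := (MessagePassing.descentStep κ ρ τ)^[T] MessagePassing.descentInit
  r := ⟨fun z => z.2.2 0, by fun_prop⟩

lemma descent_eval {m n : ℕ} (G : LCQPGraph m n) (κ ρ τ : ℝ) (T : ℕ) :
    (descent κ ρ τ T).eval G = (G.toIntervalQP.step κ ρ τ)^[T] 0 := by
  ext j
  change (((MessagePassing.descentStep κ ρ τ)^[T] MessagePassing.descentInit).features G).2 j 0 = _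
  rw [MessagePassing.features_iterate_descentStep]
  simp

end NodeGNN

/-! ### Approximation in measure -/

/-- `f` is a limit in measure of message-passing GNNs with node-level output. -/
def GNNApproximable {m n : ℕ} (μ : Measure (LCQPGraph m n))
    (f : LCQPGraph m n → EuclideanSpace ℝ (Fin n)) : Prop :=
  AEStronglyMeasurable f μ ∧
    ∀ ε > (0 : ℝ), ∀ δ > (0 : ℝ), ∃ F : NodeGNN, μ {G | ‖F.eval G - f G‖ > δ} < ENNReal.ofReal ε

namespace GNNApproximable

variable {m n : ℕ} {μ : Measure (LCQPGraph m n)}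

lemma eval (F : NodeGNN) : GNNApproximable μ fun G => F.eval G := by
  refine ⟨F.continuous_eval.aestronglyMeasurable, fun ε hε δ hδ => ⟨F, ?_⟩⟩
  simp [not_lt.2 hδ.le, hε]

/-- The class of functions approximable by GNNs is closed under almost everywhere limits. This makes
it possible to take limits of parameters one after the other. -/
lemma of_tendsto_ae [IsFiniteMeasure μ] {f : ℕ → LCQPGraph m n → EuclideanSpace ℝ (Fin n)}
    {g : LCQPGraph m n → EuclideanSpace ℝ (Fin n)} (hf : ∀ k, GNNApproximable μ (f k))
    (hlim : ∀ᵐ G ∂μ, Tendsto (fun k => f k G) atTop (𝓝 (g G))) : GNNApproximable μ g := by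
  refine ⟨aestronglyMeasurable_of_tendsto_ae atTop (fun k => (hf k).1) hlim, fun ε hε δ hδ => ?_⟩
  have hm := tendstoInMeasure_iff_norm.1
    (tendstoInMeasure_of_tendsto_ae (fun k => (hf k).1) hlim) (δ / 2) (half_pos hδ)
  obtain ⟨k, hk⟩ := (hm.eventually_lt_const (ENNReal.ofReal_pos.2 (half_pos hε))).exists
  obtain ⟨F, hF⟩ := (hf k).2 (ε / 2) (half_pos hε) (δ / 2) (half_pos hδ)
  refine ⟨F, ?_⟩
  calc μ {G | ‖F.eval G - g G‖ > δ}
      ≤ μ ({G | ‖F.eval G - f k G‖ > δ / 2} ∪ {G | δ / 2 ≤ ‖f k G - g G‖}) := by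
        refine measure_mono fun G hG => ?_
        by_contra h
        simp only [Set.mem_union, Set.mem_ofPred_eq, not_or, not_lt, not_le, gt_iff_lt] at h hG
        have := norm_sub_le_norm_sub_add_norm_sub (F.eval G) (f k G) (g G)
        linarith
    _ ≤ μ {G | ‖F.eval G - f k G‖ > δ / 2} + μ {G | δ / 2 ≤ ‖f k G - g G‖} := measure_union_le _ _
    _ < ENNReal.ofReal (ε / 2) + ENNReal.ofReal (ε / 2) := ENNReal.add_lt_add hF hk
    _ = ENNReal.ofReal ε := by
        rw [← ENNReal.ofReal_add (half_pos hε).le (half_pos hε).le, add_halves]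

variable [IsFiniteMeasure μ]

lemma of_grad_eq_zero {κ ρ : ℝ} (hκ : 0 < κ) (hρ : 0 ≤ ρ)
    {z : LCQPGraph m n → EuclideanSpace ℝ (Fin n)}
    (hz : ∀ G : LCQPGraph m n, G.toIntervalQP.grad κ ρ (z G) = 0) : GNNApproximable μ z := by
  refine of_tendsto_ae
    (fun k : ℕ => eval (NodeGNN.descent κ ρ (1 / ((k : ℝ) + 1)) ((k + 1) ^ 2))) (.of_forall ?_)
  intro G
  simp only [NodeGNN.descent_eval]
  exact G.toIntervalQP.tendsto_iterate_step hκ hρ (hz G)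

lemma of_isMin {κ : ℝ} (hκ : 0 < κ) {z : LCQPGraph m n → EuclideanSpace ℝ (Fin n)}
    (hz : ∀ᵐ G ∂μ, G.toIntervalQP.IsMin κ (z G)) : GNNApproximable μ z := by
  choose x hx using fun (k : ℕ) (G : LCQPGraph m n) =>
    G.toIntervalQP.exists_grad_eq_zero hκ (Nat.cast_nonneg k)
  refine of_tendsto_ae (fun k => of_grad_eq_zero hκ (Nat.cast_nonneg k) (hx k)) ?_
  filter_upwards [hz] with G hG
  exact IntervalQP.tendsto_penalized hκ (fun k => hx k G) hG

theorem sol (hμ : ∀ᵐ G ∂μ, G.FeasibleBounded) : GNNApproximable μ LCQPGraph.sol := by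
  have hmin : ∀ (k : ℕ) (G : LCQPGraph m n), ∃ x, G.FeasibleBounded →
      G.toIntervalQP.IsMin (1 / ((k : ℝ) + 1)) x := fun k G => by
    by_cases hG : G.FeasibleBounded
    · obtain ⟨y, hy⟩ := hG.exists_isFeasible
      obtain ⟨x, hx⟩ := G.toIntervalQP.exists_isMin (κ := 1 / ((k : ℝ) + 1)) (by positivity)
        ⟨y, LCQPGraph.mem_feasible_toIntervalQP.2 hy⟩
      exact ⟨x, fun _ => hx⟩
    · exact ⟨0, fun h => absurd h hG⟩
  choose x hx using hmin
  refine of_tendsto_ae (f := x) (fun k => of_isMin (κ := 1 / ((k : ℝ) + 1)) (by positivity) ?_) ?_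
  · filter_upwards [hμ] with G hG using hx k G hG
  · filter_upwards [hμ] with G hG
    exact IntervalQP.tendsto_isMinNormMin (fun k => hx k G hG)
      (LCQPGraph.isMinNormMin_toIntervalQP.2 hG.isMinNormOptimal_sol)

end GNNApproximable

theorem theorem3p3 (m n : ℕ) :
    (∀ G : LCQPGraph m n, G.FeasibleBounded → ∃! x, G.IsMinNormOptimal x) ∧
    ∀ (μ : Measure (LCQPGraph m n)) [IsProbabilityMeasure μ],
      (∀ᵐ G ∂μ, G.FeasibleBounded) →
      ∀ ε > (0 : ℝ), ∀ δ > (0 : ℝ),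
        ∃ F : NodeGNN, μ {G | ‖F.eval G - G.sol‖ > δ} < ENNReal.ofReal ε :=
  ⟨fun _ hG => hG.existsUnique_isMinNormOptimal, fun _ _ hμ => (GNNApproximable.sol hμ).2⟩
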